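/- **Theorem (cofibrant replacement).** Let $\mathcal C$ be a finite poset regarded as a category, with a unique morphism $\phi_{xy}:x\to y$ if and only if $x\le y$. Let $\mathbf{f\text{-}s\text{-}sets}$ be the category of simplicial sets all of whose skeleta are finite (i.e. with finitely many simplices in each dimension) and simplicial maps, and let $F:\mathcal C\to\mathbf{f\text{-}s\text{-}sets}$ be a functor. Then there are a functor $\widetilde F:\mathcal C\to\mathbf{f\text{-}s\text{-}sets}$ and a natural transformation $\eta:\widetilde F\to F$ such that 1. for every morphism $\phi_{xy}$ of $\mathcal C$ the map $\widetilde F(\phi_{xy}):\widetilde F(x)\to\widetilde F(y)$ is injective (a cofibration of simplicial sets); 2. for every object $x$ the map $\eta(x):\widetilde F(x)\to F(x)$ is a weak homotopy equivalence; 3. $\widetilde F$ is built inductively from mapping cylinders: for every $x$, let $f_x:\operatorname{colim}_{y<x}\widetilde F(y)\to\operatorname{colim}_{y<x}F(y)\to F(x)$ be the map induced by $\eta$ and the structure maps of $F$, the colimits being taken over the slice category $\mathcal C/x$ with its terminal object $\mathrm{id}_x$ removed. Let $\mathrm{Cyl}(f_x)$ be the simplicial mapping cylinder of $f_x$, obtained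 from $\bigl(\operatorname{colim}_{y<x}\widetilde F(y)\bigr)\times\Delta[1]$ by gluing its end at $1$ to $F(x)$ along $f_x$. Then there is an isomorphism $\widetilde F(x)\cong\mathrm{Cyl}(f_x)$ under which $\widetilde F(\phi_{yx})$, for $y<x$, is the canonical map $\widetilde F(y)\to\operatorname{colim}_{y<x}\widetilde F(y)$ followed by the inclusion of the colimit as the end at $0$ of $\mathrm{Cyl}(f_x)$, and $\eta(x)$ is the collapsing map $\mathrm{Cyl}(f_x)\to F(x)$. Here a map $f:X\to Y$ of simplicial sets is a weak homotopy equivalence if for every Kan complex $Z$ precomposition with $f$ is a bijection $[Y,Z]\to[X,Z]$ of simplicial homotopy classes of maps (equivalently, its geometric realization is a weak homotopy equivalence). -/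

import Mathlib

open CategoryTheory CategoryTheory.Limits Simplicial MonoidalCategory CartesianMonoidalCategory

universe u v

noncomputable section

namespace CofRepl

/-- A simplicial set has finite skeleta if each of its skeleta is a finite simplicial set
(has finitely many nondegenerate simplices). In Mathlib, `X.skeleton n` is generated by the
simplices of dimension `< n`. -/
def HasFiniteSkeleta : ObjectProperty SSet.{u} :=
  fun X => ∀ n : ℕ, SSet.Finite (X.skeleton n : SSet.{u})

/-- The category of simplicial sets with finite skeleta and all simplicial maps between them. -/
abbrev FSSet : Type (u + 1) := HasFiniteSkeleta.{u}.FullSubcategory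

/-- The set `[X, Z]` of simplicial maps `X ⟶ Z` modulo the equivalence relation generated by
simplicial homotopy. -/
def HtpyClasses (X Z : SSet.{u}) : Type u :=
  Quot (fun f g : X ⟶ Z => Nonempty (SSet.Homotopy f g))

/-- The map `[Y, Z] → [X, Z]` given by precomposition with `f : X ⟶ Y`. -/
def HtpyClasses.precomp {X Y : SSet.{u}} (f : X ⟶ Y) (Z : SSet.{u}) :
    HtpyClasses Y Z → HtpyClasses X Z :=
  Quot.map (fun g => f ≫ g) (by
    rintro g g' ⟨H⟩
    exact ⟨SSet.RelativeMorphism.Homotopy.precomp H (SSet.RelativeMorphism.botEquiv.symm f)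
      (SSet.Subcomplex.isInitialBot.hom_ext _ _)⟩)

/-- Weak (homotopy) equivalences of simplicial sets: maps `f : X ⟶ Y` inducing a bijection
`[Y, Z] → [X, Z]` for every Kan complex `Z`. -/
def IsWeakEquiv {X Y : SSet.{u}} (f : X ⟶ Y) : Prop :=
  ∀ (Z : SSet.{u}) [SSet.KanComplex Z], Function.Bijective (HtpyClasses.precomp f Z)

/-- The simplicial mapping cylinder of `f : X ⟶ Y`: the cylinder `X ⊗ Δ[1]` with its end
`X ⊗ {1}` glued to `Y` along `f`. -/
abbrev Cyl {X Y : SSet.{u}} (f : X ⟶ Y) : SSet.{u} :=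
  pushout (SSet.ι₁ : X ⟶ X ⊗ Δ[1]) f

/-- The inclusion of `X` as the free end `X ⊗ {0}` of the mapping cylinder of `f : X ⟶ Y`. -/
def Cyl.incl {X Y : SSet.{u}} (f : X ⟶ Y) : X ⟶ Cyl f :=
  SSet.ι₀ ≫ pushout.inl (SSet.ι₁ : X ⟶ X ⊗ Δ[1]) f

/-- The collapsing map from the mapping cylinder of `f : X ⟶ Y` to `Y`: it is the identity
on `Y`, and the projection to `X` followed by `f` on `X ⊗ Δ[1]`. -/
def Cyl.collapse {X Y : SSet.{u}} (f : X ⟶ Y) : Cyl f ⟶ Y :=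
  pushout.desc (fst X Δ[1] ≫ f) (𝟙 Y) (by
    rw [← Category.assoc, SSet.ι₁_fst, Category.id_comp, Category.comp_id])

section Slice

variable {C : Type v} [PartialOrder C]

/-- The forgetful functor `(y → x) ↦ y` on the proper slice of a poset category over `x`, i.e.
the slice category without the identity of `x`. An object `y → x` with `y ≠ x` is the same
as an element `y < x`. -/
abbrev sliceForget (x : C) : Set.Iio x ⥤ C :=
  Monotone.functor (f := fun y : Set.Iio x => (y : C)) (fun _ _ h => h)

instance hasColimitsOfShape_Iio [Finite C] (x : C) :
    HasColimitsOfShape (Set.Iio x) SSet.{u} := by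
  have : Fintype (Set.Iio x) := Fintype.ofFinite _
  have : FinCategory (Set.Iio x) := { fintypeHom := fun _ _ => Fintype.ofFinite _ }
  infer_instance

/-- The colimit of a diagram `G` over the proper slice over `x`. -/
abbrev sliceColim [Finite C] (G : C ⥤ SSet.{u}) (x : C) : SSet.{u} :=
  colimit (sliceForget x ⋙ G)

/-- The cocone on the restriction of `G` to the proper slice over `x`, with point `G x`, given
by the structure maps of `G`. -/
abbrev sliceCocone (G : C ⥤ SSet.{u}) (x : C) : Cocone (sliceForget x ⋙ G) where
  pt := G.obj x
  ι :=
    { app := fun y => G.map (homOfLE (le_of_lt y.2))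
      naturality := fun y z h => by
        dsimp
        rw [← G.map_comp, Category.comp_id]
        rfl }

/-- For `η : G ⟶ F`, the map `colim_{y < x} G y ⟶ colim_{y < x} F y ⟶ F x`. -/
def sliceMap [Finite C] {G F : C ⥤ SSet.{u}} (η : G ⟶ F) (x : C) :
    sliceColim G x ⟶ F.obj x :=
  colimMap (Functor.whiskerLeft (sliceForget x) η) ≫ colimit.desc _ (sliceCocone F x)

/-- The diagram `G` and the transformation `η : G ⟶ F` are, up to isomorphism, built
inductively from mapping cylinders: at each `x`, the value `G x` is the mapping cylinder of
`colim_{y < x} G y ⟶ F x`, the structure maps into `G x` are the canonical maps to the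
colimit followed by its inclusion in the cylinder, and `η x` is the collapsing map. -/
def IsMappingCylinderTower [Finite C] {G F : C ⥤ SSet.{u}} (η : G ⟶ F) : Prop :=
  ∀ x : C, ∃ e : G.obj x ≅ Cyl (sliceMap η x),
    (∀ (y : C) (h : y < x),
      G.map (homOfLE (le_of_lt h)) ≫ e.hom =
        colimit.ι (sliceForget x ⋙ G) (⟨y, h⟩ : Set.Iio x) ≫ Cyl.incl (sliceMap η x)) ∧
    η.app x = e.hom ≫ Cyl.collapse (sliceMap η x)

end Slice

end CofRepl

end

/-! The free end of a mapping cylinder embeds whatever the map is, and the cylinder deformation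
retracts onto its target. So it suffices to turn `F`, one object at a time going up the poset, into
a diagram of cylinders (`exists_isMappingCylinderTower`). If all objects below `m` are done and `m`
is untouched, the structure maps into the value at `m` factor through the cylinder of `sliceMap`.
Replacing that value by the cylinder leaves the diagram below `m` unchanged up to isomorphism.

In the resulting tower `η.app x` is a collapse up to isomorphism, hence a weak equivalence, and each
map from the colimit below `x` to `G x` is mono. That each single `G y ⟶ G x` is then mono is a
separate fact about diagrams of sets: every element comes from an origin that admits no further
preimage below. Injectivity on the colimits makes this origin invariant under the structure maps,
and an element is recovered from its origin (`injective_map_of_eqvGen`). Finiteness passes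
degreewise through finite colimits and cylinders. -/

noncomputable section

namespace CofRepl

/-! ### Mapping cylinders: deformation, embedded free end, finiteness. -/

section MappingCylinder

open SSet

/-- The simplicial map `Δ[1] ⊗ Δ[1] ⟶ Δ[1]` given on vertices by the maximum. -/
def stdSimplexMax : (Δ[1] ⊗ Δ[1] : SSet.{u}) ⟶ Δ[1] where
  app _ := ↾fun s => stdSimplex.objEquiv.symm
    (SimplexCategory.Hom.mk ((stdSimplex.objEquiv s.1).toOrderHom ⊔
      (stdSimplex.objEquiv s.2).toOrderHom))
  naturality _ _ _ := rfl

lemma stdSimplexMax_app_const_one_right {n : SimplexCategoryᵒᵖ} (s : (Δ[1] : SSet.{u}).obj n) :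
    stdSimplexMax.app n (s, stdSimplex.const 1 1 n) = stdSimplex.const 1 1 n := by
  apply stdSimplex.objEquiv.injective
  apply SimplexCategory.Hom.ext
  ext i : 2
  exact sup_eq_right.2 (Fin.le_last _)

lemma stdSimplexMax_app_const_one_left {n : SimplexCategoryᵒᵖ} (s : (Δ[1] : SSet.{u}).obj n) :
    stdSimplexMax.app n (stdSimplex.const 1 1 n, s) = stdSimplex.const 1 1 n := by
  apply stdSimplex.objEquiv.injective
  apply SimplexCategory.Hom.ext
  ext i : 2
  exact sup_eq_left.2 (Fin.le_last _)

lemma stdSimplexMax_app_const_zero_right {n : SimplexCategoryᵒᵖ} (s : (Δ[1] : SSet.{u}).obj n) :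
    stdSimplexMax.app n (s, stdSimplex.const 1 0 n) = s := by
  apply stdSimplex.objEquiv.injective
  apply SimplexCategory.Hom.ext
  ext i : 2
  exact sup_eq_left.2 (Fin.zero_le _)

variable {X Y Z : SSet.{u}} (f : X ⟶ Y)

/-- The map contracting the cylinder `X ⊗ Δ[1]` onto its end at `1`. -/
def cylinderContraction (X : SSet.{u}) : (X ⊗ Δ[1]) ⊗ Δ[1] ⟶ X ⊗ Δ[1] :=
  (α_ X Δ[1] Δ[1]).hom ≫ X ◁ stdSimplexMax

lemma ι₀_cylinderContraction : ι₀ ≫ cylinderContraction X = 𝟙 _ := by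
  refine hom_ext _ _ rfl ?_
  ext n ⟨x, s⟩
  exact stdSimplexMax_app_const_zero_right s

lemma ι₁_cylinderContraction : ι₁ ≫ cylinderContraction X = fst X Δ[1] ≫ ι₁ := by
  refine hom_ext _ _ rfl ?_
  ext n ⟨x, s⟩
  exact stdSimplexMax_app_const_one_right s

lemma ι₁_whiskerRight_cylinderContraction :
    (ι₁ : X ⟶ X ⊗ Δ[1]) ▷ Δ[1] ≫ cylinderContraction X = fst X Δ[1] ≫ ι₁ := by
  refine hom_ext _ _ rfl ?_
  ext n ⟨x, s⟩
  exact stdSimplexMax_app_const_one_left s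

lemma Cyl.isPushout_whiskerRight :
    IsPushout ((ι₁ : X ⟶ X ⊗ Δ[1]) ▷ Δ[1]) (f ▷ Δ[1])
      (pushout.inl ι₁ f ▷ Δ[1]) (pushout.inr ι₁ f ▷ Δ[1]) :=
  (IsPushout.of_hasPushout (ι₁ : X ⟶ X ⊗ Δ[1]) f).map (tensorRight Δ[1])

@[simp]
lemma Cyl.inl_collapse : pushout.inl ι₁ f ≫ Cyl.collapse f = fst X Δ[1] ≫ f :=
  pushout.inl_desc _ _ _

@[simp]
lemma Cyl.inr_collapse : pushout.inr ι₁ f ≫ Cyl.collapse f = 𝟙 Y :=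
  pushout.inr_desc _ _ _

@[simp]
lemma Cyl.incl_collapse : Cyl.incl f ≫ Cyl.collapse f = f := by
  simp [Cyl.incl]

/-- The deformation of the mapping cylinder of `f : X ⟶ Y` onto `Y`. -/
def Cyl.deformation : Homotopy (𝟙 (Cyl f)) (Cyl.collapse f ≫ pushout.inr ι₁ f) where
  -- `- ⊗ Δ[1]` preserves the pushout, so the contraction by maxima glues with the constant homotopy
  -- on `Y`: it is stationary on the end at `1`.
  h := (Cyl.isPushout_whiskerRight f).desc
    (cylinderContraction X ≫ pushout.inl ι₁ f) (fst Y Δ[1] ≫ pushout.inr ι₁ f) (by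
      rw [← Category.assoc, ι₁_whiskerRight_cylinderContraction, Category.assoc,
        pushout.condition, whiskerRight_fst_assoc])
  h₀ := by
    apply pushout.hom_ext
    · rw [← ι₀_comp_assoc, IsPushout.inl_desc, ← Category.assoc, ι₀_cylinderContraction]
      simp
    · rw [← ι₀_comp_assoc, IsPushout.inr_desc, ι₀_fst_assoc]
      simp
  h₁ := by
    apply pushout.hom_ext
    · rw [← ι₁_comp_assoc, IsPushout.inl_desc, ← Category.assoc, ι₁_cylinderContraction,
        Category.assoc, pushout.condition]
      simp [reassoc_of% Cyl.inl_collapse]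
    · rw [← ι₁_comp_assoc, IsPushout.inr_desc, ι₁_fst_assoc]
      simp [reassoc_of% Cyl.inr_collapse]
  rel := by
    ext n ⟨⟨x, hx⟩, s⟩
    exact hx.elim

lemma isWeakEquiv_of_deformation {f : X ⟶ Y} {s : Y ⟶ X} (hs : s ≫ f = 𝟙 Y)
    (H : Homotopy (𝟙 X) (f ≫ s)) : IsWeakEquiv f := by
  intro Z _
  constructor
  · apply Function.LeftInverse.injective (g := HtpyClasses.precomp s Z)
    rintro ⟨g⟩
    change Quot.mk _ (s ≫ f ≫ g) = _
    rw [reassoc_of% hs]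
  · rintro ⟨g⟩
    refine ⟨Quot.mk _ (s ≫ g), ?_⟩
    exact (Quot.sound ⟨{
      h := H.h ≫ g
      h₀ := by
        rw [Homotopy.h₀_assoc]
        exact Category.id_comp g
      h₁ := by
        rw [Homotopy.h₁_assoc]
        exact Category.assoc f s g
      rel := by
        ext n ⟨⟨x, hx⟩, s⟩
        exact hx.elim }⟩).symm

lemma IsWeakEquiv.collapse : IsWeakEquiv (Cyl.collapse f) :=
  isWeakEquiv_of_deformation (Cyl.inr_collapse f) (Cyl.deformation f)

lemma IsWeakEquiv.comp_left_of_iso {W : SSet.{u}} (e : W ≅ X) {f : X ⟶ Y} (hf : IsWeakEquiv f) :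
    IsWeakEquiv (e.hom ≫ f) := by
  intro Z _
  have h : HtpyClasses.precomp (e.hom ≫ f) Z =
      HtpyClasses.precomp e.hom Z ∘ HtpyClasses.precomp f Z := by
    ext ⟨g⟩
    exact congrArg (Quot.mk _) (Category.assoc _ _ _)
  rw [h]
  refine Function.Bijective.comp ?_ (hf Z)
  refine Function.bijective_iff_has_inverse.2 ⟨HtpyClasses.precomp e.inv Z, ?_, ?_⟩
  · rintro ⟨g⟩
    exact congrArg (Quot.mk _) (e.inv_hom_id_assoc g)
  · rintro ⟨g⟩
    exact congrArg (Quot.mk _) (e.hom_inv_id_assoc g)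

lemma ι₀_app_ne_ι₁_app {n : SimplexCategoryᵒᵖ} (x y : X.obj n) :
    (ι₀ : X ⟶ X ⊗ Δ[1]).app n x ≠ (ι₁ : X ⟶ X ⊗ Δ[1]).app n y := fun h => by
  have h' : stdSimplex.const 1 0 n = stdSimplex.const.{u} 1 1 n := congrArg Prod.snd h
  -- Every simplex has a vertex `0`, at which the two constant simplices differ.
  have h₀ : (0 : Fin 2) = 1 := congrArg (fun s => (stdSimplex.objEquiv s).toOrderHom 0) h'
  exact absurd h₀ (by decide)

/-- The gluing only affects the end at `1`, which is disjoint from the end at `0`. Degreewise,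
sending `Y` and the end at `1` to `none` and every other simplex to its `X`-component is well
defined on the pushout and detects the free end. -/
instance Cyl.mono_incl : Mono (Cyl.incl f) := by
  classical
  rw [NatTrans.mono_iff_mono_app]
  intro n
  rw [mono_iff_injective]
  let r : (X ⊗ Δ[1]).obj n ⟶ Option (X.obj n) :=
    ↾fun z => if z ∈ Set.range ((ι₁ : X ⟶ X ⊗ Δ[1]).app n) then none else some z.1
  have hp := (IsPushout.of_hasPushout (ι₁ : X ⟶ X ⊗ Δ[1]) f).map
    ((evaluation SimplexCategoryᵒᵖ (Type u)).obj n)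
  let q : (Cyl f).obj n ⟶ Option (X.obj n) := hp.desc r (↾fun _ => none) (by
    apply ConcreteCategory.hom_ext
    intro x
    exact if_pos ⟨x, rfl⟩)
  have hq (x : X.obj n) : q ((Cyl.incl f).app n x) = some x := by
    have h : q ((pushout.inl ι₁ f).app n (ι₀.app n x)) = r (ι₀.app n x) :=
      ConcreteCategory.congr_hom (hp.inl_desc r (↾fun _ => none) _) (ι₀.app n x)
    refine h.trans (if_neg ?_)
    rintro ⟨y, hy⟩
    exact ι₀_app_ne_ι₁_app x y hy.symm
  intro x y h
  exact Option.some.inj ((hq x).symm.trans ((congrArg q h).trans (hq y)))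

lemma Cyl.finite_obj {n : SimplexCategoryᵒᵖ} [Finite (X.obj n)] [Finite (Y.obj n)] :
    Finite ((Cyl f).obj n) := by
  have hp := (IsPushout.of_hasPushout (ι₁ : X ⟶ X ⊗ Δ[1]) f).map
    ((evaluation SimplexCategoryᵒᵖ (Type u)).obj n)
  have : Finite ((X ⊗ Δ[1]).obj n) := inferInstanceAs (Finite (X.obj n × (Δ[1] : SSet.{u}).obj n))
  refine Finite.of_surjective
    (Sum.elim ((pushout.inl ι₁ f).app n) ((pushout.inr ι₁ f).app n)) fun z => ?_
  obtain ⟨w, hw⟩ | ⟨y, hy⟩ := Types.eq_or_eq_of_isPushout hp z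
  · exact ⟨Sum.inl w, hw⟩
  · exact ⟨Sum.inr y, hy⟩

end MappingCylinder

/-! ### Replacing one value of a diagram on a poset. -/

section Replacement

variable {C : Type v} [PartialOrder C] {D : Type*} [Category D]

/-- A factorization, through an object `K`, of all the structure maps `G x ⟶ G m` for `x < m`
of a functor `G` on a poset. -/
structure LatchingFactorization (G : C ⥤ D) (m : C) where
  /-- the object through which the structure maps factor -/
  K : D
  /-- the first maps of the factorization -/
  i (x : C) (h : x < m) : G.obj x ⟶ K
  map_i (x y : C) (hxy : x ≤ y) (hy : y < m) :
    G.map (homOfLE hxy) ≫ i y hy = i x (hxy.trans_lt hy)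
  /-- the second map of the factorization -/
  r : K ⟶ G.obj m
  i_r (x : C) (h : x < m) : i x h ≫ r = G.map (homOfLE h.le)

namespace LatchingFactorization

variable {G : C ⥤ D} {m : C} (L : LatchingFactorization G m)

/-- Auxiliary definition for `LatchingFactorization.functor`. -/
def objAux (x : C) (d : Decidable (x = m)) : D :=
  match d with
  | .isTrue _ => L.K
  | .isFalse _ => G.obj x

/-- Auxiliary definition for `LatchingFactorization.functor`. -/
def mapAux {x y : C} (h : x ≤ y) (dx : Decidable (x = m)) (dy : Decidable (y = m)) :
    L.objAux x dx ⟶ L.objAux y dy :=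
  match dx, dy with
  | .isTrue _, .isTrue _ => 𝟙 L.K
  | .isTrue hx, .isFalse _ => L.r ≫ G.map (homOfLE (hx ▸ h))
  | .isFalse hx, .isTrue hy => L.i x (lt_of_le_of_ne (hy ▸ h) hx)
  | .isFalse _, .isFalse _ => G.map (homOfLE h)

/-- Keeping the decision of `x = m` as a variable lets case analysis reduce objects and maps
definitionally, with no transport along `x = m`. -/
lemma mapAux_id (x : C) (d : Decidable (x = m)) : L.mapAux le_rfl d d = 𝟙 (L.objAux x d) := by
  cases d with
  | isTrue _ => rfl
  | isFalse _ => exact G.map_id x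

lemma mapAux_comp {x y z : C} (hxy : x ≤ y) (hyz : y ≤ z) (dx : Decidable (x = m))
    (dy : Decidable (y = m)) (dz : Decidable (z = m)) :
    L.mapAux (hxy.trans hyz) dx dz = L.mapAux hxy dx dy ≫ L.mapAux hyz dy dz := by
  cases dx with
  | isTrue hx =>
    cases dz with
    | isTrue hz =>
      cases dy with
      | isTrue hy => exact (Category.id_comp _).symm
      | isFalse hy => exact absurd (le_antisymm (hz ▸ hyz) (hx ▸ hxy)) hy
    | isFalse hz =>
      cases dy with
      | isTrue hy => exact (Category.id_comp _).symm
      | isFalse hy =>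
        exact (congrArg (L.r ≫ ·) (G.map_comp (homOfLE (hx ▸ hxy)) (homOfLE hyz))).trans
          (Category.assoc _ _ _).symm
  | isFalse hx =>
    cases dz with
    | isTrue hz =>
      cases dy with
      | isTrue hy => exact (Category.comp_id _).symm
      | isFalse hy => exact (L.map_i x y hxy _).symm
    | isFalse hz =>
      cases dy with
      | isTrue hy =>
        have h : x < m := lt_of_le_of_ne (hy ▸ hxy) hx
        exact (G.map_comp (homOfLE h.le) (homOfLE (hy ▸ hyz))).trans
          ((congrArg (· ≫ _) (L.i_r x h).symm).trans (Category.assoc _ _ _))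
      | isFalse hy => exact G.map_comp (homOfLE hxy) (homOfLE hyz)

open scoped Classical in
/-- The functor obtained from `G` by replacing `G m` by the object `K` of a factorization
of the structure maps `G x ⟶ G m` for `x < m`. -/
def functor : C ⥤ D where
  obj x := L.objAux x (inferInstance : Decidable (x = m))
  map f := L.mapAux (leOfHom f) _ _
  map_id x := L.mapAux_id x _
  map_comp f g := L.mapAux_comp (leOfHom f) (leOfHom g) _ _ _

/-- Auxiliary definition for `LatchingFactorization.toSelf`. -/
def appAux (x : C) (d : Decidable (x = m)) : L.objAux x d ⟶ G.obj x :=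
  match d with
  | .isTrue h => L.r ≫ G.map (homOfLE h.ge)
  | .isFalse _ => 𝟙 (G.obj x)

lemma mapAux_appAux {x y : C} (h : x ≤ y) (dx : Decidable (x = m)) (dy : Decidable (y = m)) :
    L.mapAux h dx dy ≫ L.appAux y dy = L.appAux x dx ≫ G.map (homOfLE h) := by
  cases dx with
  | isTrue hx =>
    cases dy with
    | isTrue hy =>
      change 𝟙 _ ≫ L.r ≫ _ = (L.r ≫ _) ≫ _
      rw [Category.id_comp, Category.assoc]
      exact congrArg (L.r ≫ ·) (G.map_comp (homOfLE hx.ge) (homOfLE h))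
    | isFalse hy =>
      exact ((Category.comp_id _).trans
        (congrArg (L.r ≫ ·) (G.map_comp (homOfLE hx.ge) (homOfLE h)))).trans
          (Category.assoc _ _ _).symm
  | isFalse hx =>
    cases dy with
    | isTrue hy =>
      change L.i x _ ≫ L.r ≫ _ = 𝟙 _ ≫ _
      rw [Category.id_comp, ← Category.assoc, L.i_r]
      exact (G.map_comp (homOfLE (hy ▸ h)) (homOfLE hy.ge)).symm
    | isFalse hy => exact (Category.comp_id _).trans (Category.id_comp _).symm

/-- The canonical transformation from the functor with `G m` replaced to `G`. -/
def toSelf : L.functor ⟶ G where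
  app x := L.appAux x _
  naturality _ _ f := L.mapAux_appAux (leOfHom f) _ _

lemma isIso_toSelf_app {x : C} (hx : x ≠ m) : IsIso (L.toSelf.app x) := by
  have (d : Decidable (x = m)) : IsIso (L.appAux x d) := by
    cases d with
    | isTrue h => exact absurd h hx
    | isFalse _ => exact inferInstanceAs (IsIso (𝟙 (G.obj x)))
  exact this _

/-- Auxiliary definition for `LatchingFactorization.iso`. -/
def isoAux (d : Decidable (m = m)) : L.objAux m d ≅ L.K :=
  match d with
  | .isTrue _ => Iso.refl _
  | .isFalse h => absurd rfl h

/-- The value at `m` of the functor `L.functor` is `L.K`. -/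
def iso : L.functor.obj m ≅ L.K := L.isoAux _

lemma functor_map_iso_hom {x : C} (h : x < m) :
    L.functor.map (homOfLE h.le) ≫ L.iso.hom = L.toSelf.app x ≫ L.i x h := by
  have (dx : Decidable (x = m)) (dm : Decidable (m = m)) :
      L.mapAux h.le dx dm ≫ (L.isoAux dm).hom = L.appAux x dx ≫ L.i x h := by
    cases dx with
    | isTrue hx => exact absurd hx h.ne
    | isFalse hx =>
      cases dm with
      | isTrue _ => exact (Category.comp_id _).trans (Category.id_comp _).symm
      | isFalse hm => exact absurd rfl hm
  exact this _ _

lemma toSelf_app_self : L.toSelf.app m = L.iso.hom ≫ L.r := by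
  have (d : Decidable (m = m)) : L.appAux m d = (L.isoAux d).hom ≫ L.r := by
    cases d with
    | isTrue _ =>
      change L.r ≫ G.map (𝟙 m) = 𝟙 _ ≫ _
      rw [G.map_id, Category.comp_id, Category.id_comp]
    | isFalse h => exact absurd rfl h
  exact this _

end LatchingFactorization

end Replacement

/-! ### Construction of the tower of mapping cylinders. -/

section Tower

variable {X X' Y : SSet.{u}}

/-- The morphism of mapping cylinders induced by a morphism of the sources. -/
def Cyl.map (a : X' ⟶ X) {f : X ⟶ Y} {f' : X' ⟶ Y} (h : a ≫ f = f') : Cyl f' ⟶ Cyl f :=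
  pushout.desc (a ▷ Δ[1] ≫ pushout.inl SSet.ι₁ f) (pushout.inr SSet.ι₁ f) (by
    rw [SSet.ι₁_comp_assoc, pushout.condition, ← h, Category.assoc])

@[simp]
lemma Cyl.inl_map (a : X' ⟶ X) {f : X ⟶ Y} {f' : X' ⟶ Y} (h : a ≫ f = f') :
    pushout.inl SSet.ι₁ f' ≫ Cyl.map a h = a ▷ Δ[1] ≫ pushout.inl SSet.ι₁ f :=
  pushout.inl_desc _ _ _

@[simp]
lemma Cyl.inr_map (a : X' ⟶ X) {f : X ⟶ Y} {f' : X' ⟶ Y} (h : a ≫ f = f') :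
    pushout.inr SSet.ι₁ f' ≫ Cyl.map a h = pushout.inr SSet.ι₁ f :=
  pushout.inr_desc _ _ _

/-- The isomorphism of mapping cylinders induced by an isomorphism of the sources. -/
def Cyl.isoOfIso (a : X' ≅ X) {f : X ⟶ Y} {f' : X' ⟶ Y} (h : a.hom ≫ f = f') :
    Cyl f' ≅ Cyl f where
  hom := Cyl.map a.hom h
  inv := Cyl.map a.inv ((Iso.inv_comp_eq a).2 h.symm)
  hom_inv_id := by
    apply pushout.hom_ext <;>
      simp [reassoc_of% @Cyl.inl_map, reassoc_of% @Cyl.inr_map, ← comp_whiskerRight_assoc]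
  inv_hom_id := by
    apply pushout.hom_ext <;>
      simp [reassoc_of% @Cyl.inl_map, reassoc_of% @Cyl.inr_map, ← comp_whiskerRight_assoc]

lemma Cyl.incl_isoOfIso_hom (a : X' ≅ X) {f : X ⟶ Y} {f' : X' ⟶ Y} (h : a.hom ≫ f = f') :
    Cyl.incl f' ≫ (Cyl.isoOfIso a h).hom = a.hom ≫ Cyl.incl f := by
  simp [Cyl.incl, Cyl.isoOfIso]

lemma Cyl.isoOfIso_hom_collapse (a : X' ≅ X) {f : X ⟶ Y} {f' : X' ⟶ Y} (h : a.hom ≫ f = f') :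
    (Cyl.isoOfIso a h).hom ≫ Cyl.collapse f = Cyl.collapse f' := by
  apply pushout.hom_ext <;>
    simp [Cyl.isoOfIso, reassoc_of% @Cyl.inl_map, reassoc_of% @Cyl.inr_map, h]

variable {C : Type v} [PartialOrder C] [Finite C] {F G G' : C ⥤ SSet.{u}}

variable (G) in
/-- The canonical map `G y ⟶ colim_{z < x} G z` for `y < x`. -/
def sliceι {x y : C} (h : y < x) : G.obj y ⟶ sliceColim G x :=
  colimit.ι (sliceForget x ⋙ G) (⟨y, h⟩ : Set.Iio x)

lemma sliceColim_hom_ext {x : C} {Z : SSet.{u}} {f g : sliceColim G x ⟶ Z}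
    (h : ∀ (y : C) (hy : y < x), sliceι G hy ≫ f = sliceι G hy ≫ g) : f = g :=
  colimit.hom_ext fun y => h y y.2

lemma map_sliceι {x y z : C} (hyz : y ≤ z) (hz : z < x) :
    G.map (homOfLE hyz) ≫ sliceι G hz = sliceι G (hyz.trans_lt hz) :=
  colimit.w (sliceForget x ⋙ G) (homOfLE hyz : (⟨y, hyz.trans_lt hz⟩ : Set.Iio x) ⟶ ⟨z, hz⟩)

lemma sliceι_colimMap (ρ : G' ⟶ G) {x y : C} (h : y < x) :
    sliceι G' h ≫ colimMap (Functor.whiskerLeft (sliceForget x) ρ) = ρ.app y ≫ sliceι G h :=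
  ι_colimMap (Functor.whiskerLeft (sliceForget x) ρ) (⟨y, h⟩ : Set.Iio x)

lemma sliceι_desc {x y : C} (h : y < x) :
    sliceι G h ≫ colimit.desc (sliceForget x ⋙ G) (sliceCocone G x) = G.map (homOfLE h.le) :=
  colimit.ι_desc (sliceCocone G x) (⟨y, h⟩ : Set.Iio x)

lemma sliceι_sliceMap (η : G ⟶ F) {x y : C} (h : y < x) :
    sliceι G h ≫ sliceMap η x = η.app y ≫ F.map (homOfLE h.le) := by
  rw [sliceMap, reassoc_of% sliceι_colimMap, sliceι_desc]

lemma sliceMap_comp (ρ : G' ⟶ G) (η : G ⟶ F) (x : C) :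
    sliceMap (ρ ≫ η) x =
      colimMap (Functor.whiskerLeft (sliceForget x) ρ) ≫ sliceMap η x := by
  apply sliceColim_hom_ext
  intro y h
  rw [sliceι_sliceMap, reassoc_of% sliceι_colimMap, sliceι_sliceMap,
    NatTrans.comp_app, Category.assoc]

/-- The condition `IsMappingCylinderTower` at a single object `x`. -/
def IsMappingCylinderAt (η : G ⟶ F) (x : C) : Prop :=
  ∃ e : G.obj x ≅ Cyl (sliceMap η x),
    (∀ (y : C) (h : y < x),
      G.map (homOfLE (le_of_lt h)) ≫ e.hom = sliceι G h ≫ Cyl.incl (sliceMap η x)) ∧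
    η.app x = e.hom ≫ Cyl.collapse (sliceMap η x)

/-- An isomorphism below `x` identifies the two colimits and hence the two cylinders. Nothing is
asked of `ρ.app x` to be invertible, so this covers the newly replaced object. -/
lemma IsMappingCylinderAt.of_iso (ρ : G' ⟶ G) (η : G ⟶ F) (x : C)
    (hρ : ∀ y < x, IsIso (ρ.app y)) (e : G'.obj x ≅ Cyl (sliceMap η x))
    (he : ∀ (y : C) (h : y < x), G'.map (homOfLE h.le) ≫ e.hom =
      ρ.app y ≫ sliceι G h ≫ Cyl.incl (sliceMap η x))
    (he' : ρ.app x ≫ η.app x = e.hom ≫ Cyl.collapse (sliceMap η x)) :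
    IsMappingCylinderAt (ρ ≫ η) x := by
  have (y : Set.Iio x) : IsIso ((Functor.whiskerLeft (sliceForget x) ρ).app y) := hρ y y.2
  have : IsIso (Functor.whiskerLeft (sliceForget x) ρ) := NatIso.isIso_of_isIso_app _
  let a : sliceColim G' x ≅ sliceColim G x :=
    HasColimit.isoOfNatIso (asIso (Functor.whiskerLeft (sliceForget x) ρ))
  have ha' {y : C} (h : y < x) : sliceι G' h ≫ a.hom = ρ.app y ≫ sliceι G h := sliceι_colimMap ρ h
  have ha : a.hom ≫ sliceMap η x = sliceMap (ρ ≫ η) x := (sliceMap_comp ρ η x).symm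
  refine ⟨e ≪≫ (Cyl.isoOfIso a ha).symm, fun y h => ?_, ?_⟩
  · rw [Iso.trans_hom, ← Category.assoc, he _ h, Iso.symm_hom, Iso.comp_inv_eq, Category.assoc,
      Cyl.incl_isoOfIso_hom, reassoc_of% ha']
  · rw [← Cyl.isoOfIso_hom_collapse a ha, Iso.trans_hom, Iso.symm_hom, Category.assoc,
      Iso.inv_hom_id_assoc]
    exact he'

lemma IsMappingCylinderAt.precomp {η : G ⟶ F} {x : C} (h : IsMappingCylinderAt η x)
    (ρ : G' ⟶ G) (hρ : ∀ y ≤ x, IsIso (ρ.app y)) : IsMappingCylinderAt (ρ ≫ η) x := by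
  obtain ⟨e, he, he'⟩ := h
  have := hρ x le_rfl
  refine .of_iso ρ η x (fun y hy => hρ y hy.le) (asIso (ρ.app x) ≪≫ e) (fun y hy => ?_) ?_
  · rw [← he, Iso.trans_hom, asIso_hom, NatTrans.naturality_assoc]
  · rw [he', Iso.trans_hom, asIso_hom, Category.assoc]

/-- The factorization of the structure maps into `G m` through the mapping cylinder of
`sliceMap η m`, if `η` is an isomorphism at `m`. -/
def cylFactorization (η : G ⟶ F) (m : C) [IsIso (η.app m)] : LatchingFactorization G m where
  K := Cyl (sliceMap η m)
  i y h := sliceι G h ≫ Cyl.incl (sliceMap η m)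
  map_i x y hxy hy := (reassoc_of% map_sliceι hxy hy) _
  r := Cyl.collapse (sliceMap η m) ≫ inv (η.app m)
  i_r x h := by
    rw [Category.assoc, reassoc_of% Cyl.incl_collapse, reassoc_of% sliceι_sliceMap,
      ← η.naturality_assoc,      IsIso.hom_inv_id, Category.comp_id]

variable (F) in
theorem exists_isMappingCylinderTower :
    ∃ (G : C ⥤ SSet.{u}) (η : G ⟶ F), IsMappingCylinderTower η := by
  -- A stage is a lower set of finished objects; off it, the diagram still agrees with `F`.
  let P : Set (Set C) := {S | IsLowerSet S ∧ ∃ (G : C ⥤ SSet.{u}) (η : G ⟶ F),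
    (∀ x ∈ S, IsMappingCylinderAt η x) ∧ ∀ x ∉ S, IsIso (η.app x)}
  have hP : P.Nonempty := ⟨∅, isLowerSet_empty, F, 𝟙 F, by simp, fun x _ => inferInstance⟩
  obtain ⟨S, hS⟩ := (Set.toFinite P).exists_maximal hP
  obtain ⟨hS', G, η, hη, hη'⟩ := hS.prop
  by_cases h : Sᶜ.Nonempty
  · obtain ⟨m, hm⟩ := (Set.toFinite Sᶜ).exists_minimal h
    have hmS : m ∉ S := hm.prop
    have hlt (y : C) (hy : y < m) : y ∈ S := by
      by_contra hyS
      exact hm.not_lt hyS hy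
    have := hη' m hmS
    let L := cylFactorization η m
    refine absurd (hS.le_of_ge (y := insert m S) ⟨?_, L.functor, L.toSelf ≫ η, ?_, ?_⟩
      (Set.subset_insert m S) (Set.mem_insert m S)) hmS
    · rintro x y hyx (rfl | hx)
      · obtain rfl | hy := hyx.eq_or_lt
        · exact Set.mem_insert _ _
        · exact Set.mem_insert_of_mem _ (hlt y hy)
      · exact Set.mem_insert_of_mem _ (hS' hyx hx)
    · rintro x (rfl | hx)
      · refine .of_iso L.toSelf η x (fun y hy => L.isIso_toSelf_app hy.ne) L.iso
          (fun y hy => L.functor_map_iso_hom hy) ?_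
        rw [L.toSelf_app_self]
        simp [L, cylFactorization]
      -- Since `S` is a lower set, `m` is not below `x`, so nothing at or below `x` was changed.
      · refine (hη x hx).precomp L.toSelf fun y hy => L.isIso_toSelf_app ?_
        rintro rfl
        exact hmS (hS' hy hx)
    · intro x hx
      rw [Set.mem_insert_iff, not_or] at hx
      have := hη' x hx.2
      have := L.isIso_toSelf_app hx.1
      rw [NatTrans.comp_app]
      infer_instance
  · rw [Set.not_nonempty_iff_eq_empty, Set.compl_empty_iff] at h
    exact ⟨G, η, fun x => hη x (h ▸ Set.mem_univ x)⟩

end Tower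

/-! ### Injectivity of structure maps from injectivity on colimits. -/

section Origin

variable {C : Type v} [PartialOrder C] (H : C ⥤ Type u)

open scoped Classical in
/-- An element of `H y` for a minimal `y`, from which the element `a` of `H x` originates. -/
def origin [WellFoundedLT C] (x : C) (a : H.obj x) : Σ y, H.obj y :=
  if h : ∃ w : Σ y : Set.Iio x, H.obj y, H.map (homOfLE w.1.2.le) w.2 = a then
    origin h.choose.1 h.choose.2
  else ⟨x, a⟩
termination_by (wellFounded_lt (α := C)).wrap x
decreasing_by exact h.choose.1.2

lemma exists_map_origin [WellFoundedLT C] (x : C) (a : H.obj x) :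
    ∃ h : (origin H x a).1 ≤ x, H.map (homOfLE h) (origin H x a).2 = a := by
  suffices ∀ w, origin H x a = w → ∃ h : w.1 ≤ x, H.map (homOfLE h) w.2 = a from this _ rfl
  induction x using WellFoundedLT.induction with
  | ind x ih =>
    intro w hw
    rw [origin] at hw
    split_ifs at hw with h
    · obtain ⟨h₁, h₂⟩ := ih h.choose.1 h.choose.1.2 h.choose.2 w hw
      have h₃ : (h.choose.1 : C) ≤ x := h.choose.1.2.le
      refine ⟨h₁.trans h₃, Eq.trans ?_ h.choose_spec⟩
      exact (ConcreteCategory.congr_hom (H.map_comp (homOfLE h₁) (homOfLE h₃)) w.2).trans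
        (congrArg (H.map (homOfLE h₃)) h₂)
    · subst hw
      exact ⟨le_rfl, ConcreteCategory.congr_hom (H.map_id x) a⟩

variable {H}

/-- The hypothesis `hH` says that elements with the same image in `H x` are joined by a zigzag
strictly below `x`. By induction each step preserves origins, so the choice made in `origin` is
immaterial. -/
lemma origin_map [WellFoundedLT C]
    (hH : ∀ (x : C) (w w' : Σ y : Set.Iio x, H.obj y),
      H.map (homOfLE w.1.2.le) w.2 = H.map (homOfLE w'.1.2.le) w'.2 →
        Relation.EqvGen (sliceForget x ⋙ H).ColimitTypeRel w w')
    {x y : C} (hy : y ≤ x) (b : H.obj y) : origin H x (H.map (homOfLE hy) b) = origin H y b := by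
  induction x using WellFoundedLT.induction generalizing y with
  | ind x ih =>
    obtain rfl | hy := hy.eq_or_lt
    · exact congrArg (origin H y) (ConcreteCategory.congr_hom (H.map_id y) b)
    have h : ∃ w : Σ z : Set.Iio x, H.obj z,
      H.map (homOfLE w.1.2.le) w.2 = H.map (homOfLE hy.le) b := ⟨⟨⟨y, hy⟩, b⟩, rfl⟩
    rw [origin, dif_pos h]
    have key := hH x h.choose ⟨⟨y, hy⟩, b⟩ h.choose_spec
    have aux (w w' : Σ z : Set.Iio x, H.obj z)
        (hw : Relation.EqvGen (sliceForget x ⋙ H).ColimitTypeRel w w') :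
        origin H w.1 w.2 = origin H w'.1 w'.2 := by
      induction hw with
      | rel w w' hw =>
        obtain ⟨f, hf⟩ := hw
        rw [hf]
        exact (ih w'.1 w'.1.2 (leOfHom f) w.2).symm
      | refl => rfl
      | symm _ _ _ h => exact h.symm
      | trans _ _ _ _ _ h h' => exact h.trans h'
    exact aux _ _ key

lemma injective_map_of_eqvGen [WellFoundedLT C]
    (hH : ∀ (x : C) (w w' : Σ y : Set.Iio x, H.obj y),
      H.map (homOfLE w.1.2.le) w.2 = H.map (homOfLE w'.1.2.le) w'.2 →
        Relation.EqvGen (sliceForget x ⋙ H).ColimitTypeRel w w')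
    {x y : C} (hy : y ≤ x) : Function.Injective (H.map (homOfLE hy)) := by
  intro b b' h
  obtain ⟨h₁, h₂⟩ := exists_map_origin H y b
  obtain ⟨h₁', h₂'⟩ := exists_map_origin H y b'
  have h₃ : origin H y b = origin H y b' := by
    rw [← origin_map hH hy, h, origin_map hH hy]
  have h₄ (w w' : Σ z, H.obj z) (hw : w.1 ≤ y) (hw' : w'.1 ≤ y) (e : w = w') :
      H.map (homOfLE hw) w.2 = H.map (homOfLE hw') w'.2 := by
    subst e
    rfl
  rw [← h₂, ← h₂']
  exact h₄ _ _ h₁ h₁' h₃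

end Origin

/-! ### Cofibrations, weak equivalences and finiteness for the tower. -/

section TowerProperties

variable {C : Type v} [PartialOrder C] [Finite C] {F G : C ⥤ SSet.{u}}

lemma sliceι_app_jointly_surjective (x : C) (n : SimplexCategoryᵒᵖ)
    (a : (sliceColim G x).obj n) :
    ∃ (y : C) (h : y < x) (b : (G.obj y).obj n), (sliceι G h).app n b = a := by
  obtain ⟨y, b, hb⟩ := Types.jointly_surjective_of_isColimit
    (isColimitOfPreserves ((evaluation SimplexCategoryᵒᵖ (Type u)).obj n)
      (colimit.isColimit (sliceForget x ⋙ G))) a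
  exact ⟨y, y.2, b, hb⟩

lemma eqvGen_of_sliceι_app_eq {x y z : C} (hy : y < x) (hz : z < x) (n : SimplexCategoryᵒᵖ)
    (b : (G.obj y).obj n) (c : (G.obj z).obj n)
    (h : (sliceι G hy).app n b = (sliceι G hz).app n c) :
    Relation.EqvGen (sliceForget x ⋙ G ⋙ (evaluation SimplexCategoryᵒᵖ (Type u)).obj n).ColimitTypeRel
      ⟨⟨y, hy⟩, b⟩ ⟨⟨z, hz⟩, c⟩ := by
  let E := (evaluation SimplexCategoryᵒᵖ (Type u)).obj n
  have : HasColimit (sliceForget x ⋙ G ⋙ E) :=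
    ⟨⟨_, isColimitOfPreserves E (colimit.isColimit (sliceForget x ⋙ G))⟩⟩
  let d : (sliceColim G x).obj n ⟶ colimit (sliceForget x ⋙ G ⋙ E) :=
    (isColimitOfPreserves E (colimit.isColimit (sliceForget x ⋙ G))).desc
      (colimit.cocone (sliceForget x ⋙ G ⋙ E))
  have hd {w : C} (hw : w < x) (a : (G.obj w).obj n) : d ((sliceι G hw).app n a) =
      colimit.ι (sliceForget x ⋙ G ⋙ E) (⟨w, hw⟩ : Set.Iio x) a :=
    ConcreteCategory.congr_hom
      ((isColimitOfPreserves E (colimit.isColimit (sliceForget x ⋙ G))).fac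
        (colimit.cocone (sliceForget x ⋙ G ⋙ E)) ⟨w, hw⟩) a
  apply Types.colimit_eq
  rw [← hd, ← hd, h]

lemma mono_map_of_mono_desc
    (hG : ∀ x, Mono (colimit.desc (sliceForget x ⋙ G) (sliceCocone G x)))
    {x y : C} (φ : y ⟶ x) : Mono (G.map φ) := by
  rw [NatTrans.mono_iff_mono_app]
  intro n
  rw [mono_iff_injective]
  refine injective_map_of_eqvGen (H := G ⋙ (evaluation SimplexCategoryᵒᵖ (Type u)).obj n)
    (fun x w w' h => eqvGen_of_sliceι_app_eq w.1.2 w'.1.2 n w.2 w'.2 ?_) (leOfHom φ)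
  have := (NatTrans.mono_iff_mono_app _).1 (hG x) n
  rw [mono_iff_injective] at this
  apply this
  have key {y : C} (hy : y < x) (b : (G.obj y).obj n) :
      (colimit.desc (sliceForget x ⋙ G) (sliceCocone G x)).app n ((sliceι G hy).app n b) =
        (G.map (homOfLE hy.le)).app n b :=
    ConcreteCategory.congr_hom (NatTrans.congr_app (sliceι_desc hy) n) b
  exact (key _ _).trans (Eq.trans h (key _ _).symm)

variable {η : G ⟶ F}

lemma IsMappingCylinderTower.mono_map (hη : IsMappingCylinderTower η) {x y : C} (φ : x ⟶ y) :
    Mono (G.map φ) := by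
  refine mono_map_of_mono_desc (fun x => ?_) φ
  obtain ⟨e, he, -⟩ := hη x
  have : colimit.desc (sliceForget x ⋙ G) (sliceCocone G x) ≫ e.hom = Cyl.incl (sliceMap η x) := by
    apply sliceColim_hom_ext
    intro y hy
    rw [reassoc_of% sliceι_desc]
    exact he y hy
  exact mono_of_mono_fac this

lemma IsMappingCylinderTower.isWeakEquiv_app (hη : IsMappingCylinderTower η) (x : C) :
    IsWeakEquiv (η.app x) := by
  obtain ⟨e, -, he⟩ := hη x
  rw [he]
  exact (IsWeakEquiv.collapse _).comp_left_of_iso e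

lemma IsMappingCylinderTower.finite_obj (hη : IsMappingCylinderTower η) (n : SimplexCategoryᵒᵖ)
    [∀ x, Finite ((F.obj x).obj n)] (x : C) : Finite ((G.obj x).obj n) := by
  induction x using WellFoundedLT.induction with
  | ind x ih =>
    obtain ⟨e, -, -⟩ := hη x
    have (y : Set.Iio x) : Finite ((G.obj y).obj n) := ih y y.2
    have : Finite ((sliceColim G x).obj n) := by
      refine Finite.of_surjective (α := Σ y : Set.Iio x, (G.obj y).obj n)
        (fun w => (sliceι G w.1.2).app n w.2) fun a => ?_
      obtain ⟨y, hy, b, hb⟩ := sliceι_app_jointly_surjective x n a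
      exact ⟨⟨⟨y, hy⟩, b⟩, hb⟩
    have := Cyl.finite_obj (sliceMap η x) (n := n)
    exact Finite.of_equiv _ (e.app n).toEquiv.symm

lemma hasFiniteSkeleta_iff (X : SSet.{u}) :
    HasFiniteSkeleta X ↔ ∀ n : SimplexCategoryᵒᵖ, Finite (X.obj n) := by
  constructor
  · rintro h ⟨n⟩
    induction n using SimplexCategory.rec with | _ n
    -- The skeleton indexed by `n + 1` is generated in dimensions `< n + 1`, so it contains all
    -- `n`-simplices.
    have := h (n + 1)
    refine Finite.of_surjective
      (fun a : (X.skeleton (n + 1) : SSet.{u}).obj (Opposite.op ⦋n⦌) => a.1) fun a => ?_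
    exact ⟨⟨a, X.mem_skeleton a⟩, rfl⟩
  · intro h n
    -- A skeleton is a finite union of images of standard simplices.
    refine (SSet.finite_iSup_iff _).2 fun i => (SSet.finite_iSup_iff _).2 fun x => ?_
    rw [← SSet.yonedaEquiv.apply_symm_apply x.1, ← SSet.Subcomplex.range_eq_ofSimplex]
    infer_instance

end TowerProperties

end CofRepl

end

theorem mainTheorem10 {C : Type v} [PartialOrder C] [Finite C] (F : C ⥤ CofRepl.FSSet.{u}) :
    ∃ (F' : C ⥤ CofRepl.FSSet.{u}) (η : F' ⟶ F),
      (∀ (x y : C) (φ : x ⟶ y), Mono (F'.map φ).hom) ∧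
      (∀ x : C, CofRepl.IsWeakEquiv (η.app x).hom) ∧
      CofRepl.IsMappingCylinderTower (Functor.whiskerRight η CofRepl.HasFiniteSkeleta.ι) := by
  obtain ⟨G, η, hη⟩ :=
    CofRepl.exists_isMappingCylinderTower (F ⋙ CofRepl.HasFiniteSkeleta.ι)
  have hG (x : C) : CofRepl.HasFiniteSkeleta (G.obj x) := by
    rw [CofRepl.hasFiniteSkeleta_iff]
    intro n
    have (y : C) : Finite (((F ⋙ CofRepl.HasFiniteSkeleta.ι).obj y).obj n) :=
      (CofRepl.hasFiniteSkeleta_iff _).1 (F.obj y).property n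
    exact hη.finite_obj n x
  exact ⟨CofRepl.HasFiniteSkeleta.lift G hG,
    { app x := ObjectProperty.homMk (η.app x)
      naturality x y f := ObjectProperty.hom_ext _ (η.naturality f) },
    fun _ _ φ => hη.mono_map φ, hη.isWeakEquiv_app, hη⟩
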